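/- Let $n\ge 1$ be an integer and let $\Lambda\subseteq\mathbb{R}^n$ be a lattice of full rank. Let $\Phi$ be an endomorphism of $\mathbb{R}^n$ with $\Phi(\Lambda)\subseteq\Lambda$ all of whose (complex) eigenvalues have the same absolute value $\rho>1$, where $\rho^n\in\mathbb{N}$; in particular $\Phi$ is invertible. Let $T\subseteq\mathbb{R}^n$ be a closed set whose boundary has $n$-dimensional Lebesgue measure $0$ and which tiles $\mathbb{R}^n$ by $\Lambda$, i.e. $\bigcup_{z\in\Lambda}(z+T)=\mathbb{R}^n$ and $T\cap(z+T)\subseteq\partial T$ for all $z\in\Lambda\setminus\{0\}$. Let $\|\cdot\|$ be a norm on $\mathbb{R}^n$ whose induced operator norm satisfies $\|\Phi\|=\rho$ and $\|\Phi^{-1}\|=\rho^{-1}$, and let $r,R>0$ be reals with $$\{x\in\mathbb{R}^n:\|x\|\le r\}\subseteq T\subseteq\{x\in\mathbb{R}^n:\|x\|\le R\}.$$ Let $w$ be a positive integer with $R/r<\rho^w-1$. Let $\mathcal{D}\subseteq\Lambda$ be a reduced residue digit set modulo $\Phi^w$, i.e. $\mathcal{D}$ consists of $0$ and exactly one representative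 of each residue class of $\Lambda$ modulo $\Phi^w\Lambda$ that is not contained in $\Phi\Lambda$; suppose that $\mathcal{D}\subseteq\Phi^wT$ and that $\mathcal{D}$ has cardinality $\rho^{n(w-1)}(\rho^n-1)+1$. A sequence $\eta=(\eta_j)_{j\in\mathbb{Z}}\in\mathcal{D}^{\mathbb{Z}}$ is a width-$w$ non-adjacent form ($w$-NAF) if each block $\eta_{j+w-1}\ldots\eta_j$ of $w$ consecutive digits contains at most one non-zero digit. Define the fundamental domain $$\mathcal{F}=\Big\{\sum_{j\in\mathbb{Z}}\Phi^j\eta_j \;:\; \eta \text{ is a } w\text{-NAF with } \eta_j=0 \text{ for all } j\ge 0\Big\}.$$ Then the Hausdorff dimension of the boundary of the fundamental domain satisfies $$\dim_H \partial\mathcal{F}<n.$$ -/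

import Mathlib

/-- `T` tiles the space by translates under `Λ`: the translates cover, and
distinct translates overlap at most in the boundary. -/
def TilesBy {E : Type*} [AddCommGroup E] [TopologicalSpace E] (Λ : Submodule ℤ E) (T : Set E) :
    Prop :=
  (⋃ z ∈ Λ, (fun x => z + x) '' T) = Set.univ ∧
    ∀ z ∈ Λ, z ≠ 0 → T ∩ (fun x => z + x) '' T ⊆ frontier T

/-- `c` is the operator norm of `A` induced by the (semi)norm `N`. -/
def HasInducedNorm {E : Type*} [AddCommGroup E] [Module ℝ E] (N : Seminorm ℝ E) (A : E → E)
    (c : ℝ) : Prop :=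
  IsLUB ((fun x => N (A x)) '' {x | N x ≤ 1}) c

/-- `D` consists of `0` and exactly one representative of each residue class of `Λ` modulo
`Φ ^ w Λ` that is not contained in `Φ Λ`. Here `1 ≤ w` and `Φ Λ ⊆ Λ`, so the class of `x` is
contained in `Φ Λ` if and only if `x ∈ Φ Λ`. -/
structure IsReducedResidueDigitSet {E : Type*} [AddCommGroup E] [Module ℝ E]
    (Λ : Submodule ℤ E) (Φ : E ≃ₗ[ℝ] E) (w : ℕ) (D : Set E) : Prop where
  subset : D ⊆ Λ
  zero_mem : 0 ∈ D
  notMem_image : ∀ d ∈ D, d ≠ 0 → d ∉ Φ '' Λ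
  existsUnique : ∀ x ∈ Λ, x ∉ Φ '' Λ → ∃! d, d ∈ D ∧ x - d ∈ (Φ ^ w : E ≃ₗ[ℝ] E) '' Λ

/-- A two-sided sequence of digits is a width-`w` non-adjacent form if each block
`η_{j+w-1} … η_j` contains at most one non-zero digit. -/
def IsWNAF {E : Type*} [Zero E] (w : ℕ) (D : Set E) (η : ℤ → E) : Prop :=
  (∀ j, η j ∈ D) ∧
    ∀ j : ℤ, {i | i ∈ Set.Icc j (j + w - 1) ∧ η i ≠ 0}.Subsingleton

/-- The value `∑_{j ∈ ℤ} Φ^j η_j`. For an expanding `Φ`, a finite digit set and a sequence that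
vanishes at all large indices the series converges absolutely. -/
noncomputable def wnafValue {E : Type*} [AddCommGroup E] [Module ℝ E] [TopologicalSpace E]
    (Φ : E ≃ₗ[ℝ] E) (η : ℤ → E) : E :=
  ∑' j : ℤ, (Φ ^ j : E ≃ₗ[ℝ] E) (η j)

/-- The values of all width-`w` non-adjacent forms with integer part zero. -/
def fundamentalDomain {E : Type*} [AddCommGroup E] [Module ℝ E] [TopologicalSpace E]
    (Φ : E ≃ₗ[ℝ] E) (w : ℕ) (D : Set E) : Set E :=
  wnafValue Φ '' {η | IsWNAF w D η ∧ ∀ j : ℤ, 0 ≤ j → η j = 0}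

section

open Filter Topology MeasureTheory
open scoped ENNReal NNReal Pointwise

/-! ### Norms on finite-dimensional spaces -/

section Norms

variable {E : Type*} [NormedAddCommGroup E] [NormedSpace ℝ E]

/-! The two operator norms force `N (Φ x) = ρ * N x`, so `Φ` is a similarity for `N`. Splitting off
the leading digit of a form gives F = Φ⁻¹F ∪ ⋃_{d ≠ 0} (Φ⁻¹d + Φ⁻ʷF)
(`fundamentalDomain_eq_iUnion`). By the cardinality of the digit set, the n-th powers of the ratios
sum to ρ⁻ⁿ + ρ^(n(w-1)) (ρⁿ - 1) ρ^(-nw) = 1.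

F has interior points: every lattice point has a finite form (`exists_finite_wnaf`), so the closed
set Λ + F is dense, hence everything, and Baire's theorem applies.

Subdivide F until the pieces are smaller than a ball inside F. Some piece then lies in the interior
of F. Every piece map sends interior to interior, so the boundary is covered by its own images under
the remaining maps. Their n-th powers sum to less than 1, so some exponent s < n still gives a sum
at most 1, and iterating the cover bounds the s-dimensional Hausdorff measure
(`dimH_frontier_lt_of_subdivision`). No disjointness of the pieces is needed. -/

theorem Seminorm.continuous_of_finiteDimensional [FiniteDimensional ℝ E] (N : Seminorm ℝ E) :
    Continuous N := by
  have := N.convexOn.continuousOn isOpen_univ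
  exact continuousOn_univ.1 this

theorem Seminorm.exists_norm_le_mul [FiniteDimensional ℝ E] (N : Seminorm ℝ E)
    (hN : ∀ x, N x = 0 → x = 0) : ∃ C : ℝ, 0 < C ∧ ∀ x, ‖x‖ ≤ C * N x := by
  have : ProperSpace E := FiniteDimensional.proper_real E
  by_cases hS : (Metric.sphere (0 : E) 1).Nonempty
  · obtain ⟨x₀, hx₀, hmin⟩ := (isCompact_sphere (0 : E) 1).exists_isMinOn hS
      N.continuous_of_finiteDimensional.continuousOn
    have hpos : 0 < N x₀ := by
      refine lt_of_le_of_ne (apply_nonneg N x₀) fun h => ?_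
      have := hN x₀ h.symm
      simp [this] at hx₀
    refine ⟨(N x₀)⁻¹, inv_pos.2 hpos, fun x => ?_⟩
    rcases eq_or_ne x 0 with rfl | hx
    · simp
    have hx' : 0 < ‖x‖ := norm_pos_iff.2 hx
    have h1 : N x₀ ≤ N (‖x‖⁻¹ • x) := hmin (by simp [norm_smul, hx'.ne'])
    rw [map_smul_eq_mul, norm_inv, norm_norm, inv_mul_eq_div, le_div_iff₀ hx'] at h1
    rw [inv_mul_eq_div, le_div_iff₀ hpos]
    linarith
  · refine ⟨1, one_pos, fun x => ?_⟩
    rcases eq_or_ne x 0 with rfl | hx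
    · simp
    exact absurd ⟨‖x‖⁻¹ • x, by simp [norm_smul, norm_ne_zero_iff.2 hx]⟩ hS

end Norms

theorem HasInducedNorm.le_mul {E : Type*} [AddCommGroup E] [Module ℝ E] {N : Seminorm ℝ E}
    (hN : ∀ x, N x = 0 → x = 0) {A : E →ₗ[ℝ] E} {c : ℝ} (h : HasInducedNorm N A c) (x : E) :
    N (A x) ≤ c * N x := by
  rcases eq_or_ne x 0 with rfl | hx
  · simp
  have hpos : 0 < N x := lt_of_le_of_ne (apply_nonneg N x) fun h => hx (hN x h.symm)
  have h1 : N (A ((N x)⁻¹ • x)) ≤ c := by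
    refine h.1 ⟨(N x)⁻¹ • x, ?_, rfl⟩
    simp [map_smul_eq_mul, abs_of_pos hpos, hpos.ne']
  rwa [map_smul, map_smul_eq_mul, norm_inv, Real.norm_of_nonneg hpos.le, inv_mul_eq_div,
    div_le_iff₀ hpos] at h1

/-- The norms of `Φ` and of its inverse bound `N (Φ x)` from above and below by the same value. -/
theorem HasInducedNorm.eq_mul {E : Type*} [AddCommGroup E] [Module ℝ E] {N : Seminorm ℝ E}
    (hN : ∀ x, N x = 0 → x = 0) {Φ : E ≃ₗ[ℝ] E} {ρ : ℝ} (hρ : 0 < ρ) (h : HasInducedNorm N Φ ρ)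
    (h' : HasInducedNorm N Φ.symm ρ⁻¹) (x : E) : N (Φ x) = ρ * N x := by
  refine le_antisymm (HasInducedNorm.le_mul hN (A := Φ.toLinearMap) h x) ?_
  have h1 := HasInducedNorm.le_mul hN (A := Φ.symm.toLinearMap) h' (Φ x)
  simp only [LinearEquiv.coe_coe, LinearEquiv.symm_apply_apply] at h1
  rwa [inv_mul_eq_div, le_div_iff₀ hρ, mul_comm] at h1

section Similarity

variable {E : Type*} [AddCommGroup E] [Module ℝ E] {N : Seminorm ℝ E} {Φ : E ≃ₗ[ℝ] E} {ρ : ℝ}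

theorem Seminorm.apply_pow_of_similarity (hΦ : ∀ x, N (Φ x) = ρ * N x) (m : ℕ) (x : E) :
    N ((Φ ^ m : E ≃ₗ[ℝ] E) x) = ρ ^ m * N x := by
  induction m generalizing x with
  | zero => simp
  | succ m ih => rw [pow_succ, LinearEquiv.mul_apply, ih, hΦ]; ring

theorem Seminorm.apply_zpow_of_similarity (hρ : 0 < ρ) (hΦ : ∀ x, N (Φ x) = ρ * N x) (m : ℤ)
    (x : E) : N ((Φ ^ m : E ≃ₗ[ℝ] E) x) = ρ ^ m * N x := by
  obtain ⟨k, rfl | rfl⟩ := m.eq_nat_or_neg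
  · simpa using Seminorm.apply_pow_of_similarity hΦ k x
  · have h := Seminorm.apply_pow_of_similarity hΦ k ((Φ ^ (-(k : ℤ)) : E ≃ₗ[ℝ] E) x)
    rw [← LinearEquiv.mul_apply, ← zpow_natCast, ← zpow_add, add_neg_cancel, zpow_zero,
      LinearEquiv.coe_one, id_eq] at h
    rw [h, ← mul_assoc, zpow_neg ρ, zpow_natCast ρ, inv_mul_cancel₀ (pow_pos hρ k).ne', one_mul]

end Similarity

/-! ### Covering bound for the Hausdorff dimension -/

section Covering

variable {E : Type*} [NormedAddCommGroup E] [NormedSpace ℝ E]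

/-- Iterating a self-covering of `B` by similar copies of itself. -/
theorem exists_iterated_cover {J : Type} [Fintype J] (N : Seminorm ℝ E) {B : Set E}
    (f : J → E → E) (c : J → ℝ) {l s M : ℝ} (hc : ∀ j, 0 ≤ c j) (hcl : ∀ j, c j ≤ l)
    (hf : ∀ j x y, N (f j x - f j y) = c j * N (x - y))
    (hB : B ⊆ ⋃ j, f j '' B) (hM : ∀ x ∈ B, ∀ y ∈ B, N (x - y) ≤ M)
    (hs : ∑ j, c j ^ s ≤ 1) (k : ℕ) :
    ∃ (I : Type) (_ : Fintype I) (A : I → Set E) (b : I → ℝ), (∀ i, 0 ≤ b i) ∧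
      (∀ i, b i ≤ l ^ k) ∧ (∀ i, ∀ x ∈ A i, ∀ y ∈ A i, N (x - y) ≤ b i * M) ∧
      B ⊆ ⋃ i, A i ∧ ∑ i, b i ^ s ≤ 1 := by
  induction k with
  | zero =>
    refine ⟨Unit, inferInstance, fun _ => B, fun _ => 1, by simp, by simp, by simpa using hM,
      by simp [Set.iUnion_const], by simp⟩
  | succ k ih =>
    obtain ⟨I, _, A, b, hb, hbl, hA, hcov, hsum⟩ := ih
    refine ⟨J × I, inferInstance, fun p => f p.1 '' A p.2, fun p => c p.1 * b p.2,
      fun p => mul_nonneg (hc _) (hb _), fun p => ?_, ?_, ?_, ?_⟩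
    · rw [pow_succ']
      exact mul_le_mul (hcl _) (hbl _) (hb _) ((hc p.1).trans (hcl p.1))
    · rintro ⟨j, i⟩ _ ⟨x, hx, rfl⟩ _ ⟨y, hy, rfl⟩
      simp only
      rw [hf, mul_assoc]
      exact mul_le_mul_of_nonneg_left (hA i x hx y hy) (hc j)
    · intro x hx
      obtain ⟨j, y, hy, rfl⟩ := Set.mem_iUnion.1 (hB hx)
      obtain ⟨i, hi⟩ := Set.mem_iUnion.1 (hcov hy)
      exact Set.mem_iUnion.2 ⟨(j, i), y, hi, rfl⟩
    · rw [Fintype.sum_prod_type]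
      calc ∑ j, ∑ i, (c j * b i) ^ s = (∑ j, c j ^ s) * ∑ i, b i ^ s := by
            rw [Finset.sum_mul_sum]
            simp_rw [Real.mul_rpow (hc _) (hb _)]
        _ ≤ 1 * 1 := mul_le_mul hs hsum
            (Finset.sum_nonneg fun i _ => Real.rpow_nonneg (hb i) s) zero_le_one
        _ = 1 := one_mul 1

/-- In the k-fold cover the s-th powers of the ratios still sum to at most 1, while the diameters
are at most C M lᵏ → 0. Hence the s-dimensional Hausdorff measure of `B` is at most (C M)ˢ. -/
theorem dimH_le_of_subset_iUnion_image {J : Type} [Fintype J] (N : Seminorm ℝ E) {C : ℝ}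
    (hC : 0 < C) (hNC : ∀ x, ‖x‖ ≤ C * N x) {B : Set E}
    (f : J → E → E) (c : J → ℝ) {l : ℝ} {s : ℝ≥0} {M : ℝ} (hc : ∀ j, 0 ≤ c j)
    (hl0 : 0 ≤ l) (hl : l < 1) (hcl : ∀ j, c j ≤ l)
    (hf : ∀ j x y, N (f j x - f j y) = c j * N (x - y))
    (hB : B ⊆ ⋃ j, f j '' B) (hM0 : 0 ≤ M) (hM : ∀ x ∈ B, ∀ y ∈ B, N (x - y) ≤ M)
    (hs : ∑ j, c j ^ (s : ℝ) ≤ 1) : dimH B ≤ s := by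
  borelize E
  choose I hI A b hb hbl hA hcov hsum using
    exists_iterated_cover N f c hc hcl hf hB hM hs
  have hdiam : ∀ k i, Metric.ediam (A k i) ≤ ENNReal.ofReal (C * M * b k i) := by
    intro k i
    refine Metric.ediam_le fun x hx y hy => ?_
    rw [edist_dist]
    refine ENNReal.ofReal_le_ofReal ?_
    rw [dist_eq_norm]
    calc ‖x - y‖ ≤ C * N (x - y) := hNC _
      _ ≤ C * (b k i * M) := mul_le_mul_of_nonneg_left (hA k i x hx y hy) hC.le
      _ = C * M * b k i := by ring
  have hCM : 0 ≤ C * M := mul_nonneg hC.le hM0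
  have key := Measure.hausdorffMeasure_le_liminf_sum (s : ℝ) B
    (l := atTop) (fun k : ℕ => ENNReal.ofReal (C * M * l ^ k)) (by
      have h := (tendsto_pow_atTop_nhds_zero_of_lt_one hl0 hl).const_mul (C * M)
      simpa using ENNReal.tendsto_ofReal h) A
    (Eventually.of_forall fun k i => (hdiam k i).trans
      (ENNReal.ofReal_le_ofReal (mul_le_mul_of_nonneg_left (hbl k i) hCM)))
    (Eventually.of_forall hcov)
  refine dimH_le_of_hausdorffMeasure_ne_top (ne_top_of_le_ne_top
    (ENNReal.ofReal_ne_top (r := (C * M) ^ (s : ℝ))) (key.trans ?_))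
  refine liminf_le_of_frequently_le' (Frequently.of_forall fun k => ?_)
  calc ∑ i, Metric.ediam (A k i) ^ (s : ℝ)
      ≤ ∑ i, ENNReal.ofReal ((C * M) ^ (s : ℝ) * b k i ^ (s : ℝ)) := by
        refine Finset.sum_le_sum fun i _ => ?_
        rw [← Real.mul_rpow hCM (hb k i),
          ← ENNReal.ofReal_rpow_of_nonneg (mul_nonneg hCM (hb k i)) s.coe_nonneg]
        exact ENNReal.rpow_le_rpow (hdiam k i) s.coe_nonneg
    _ = ENNReal.ofReal ((C * M) ^ (s : ℝ) * ∑ i, b k i ^ (s : ℝ)) := by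
        rw [Finset.mul_sum, ENNReal.ofReal_sum_of_nonneg]
        exact fun i _ => mul_nonneg (Real.rpow_nonneg hCM _) (Real.rpow_nonneg (hb k i) _)
    _ ≤ ENNReal.ofReal ((C * M) ^ (s : ℝ)) :=
        ENNReal.ofReal_le_ofReal (mul_le_of_le_one_right (Real.rpow_nonneg hCM _) (hsum k))

end Covering

/-! ### The boundary of a self-affine set with similarity dimension `n` -/

section SelfSimilar

/-- The subdivision of a self-similar set can be refined to pieces of arbitrarily high level. -/
theorem exists_iterated_subdivision {E : Type*} [AddCommGroup E] [Module ℝ E] (Φ : E ≃ₗ[ℝ] E)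
    {F : Set E} {J : Type} [Fintype J] (a : J → E) (m : J → ℕ) {p : ℝ}
    (hF : F = ⋃ j, (fun x => a j + (Φ ^ (-(m j : ℤ)) : E ≃ₗ[ℝ] E) x) '' F)
    (hm : ∀ j, 1 ≤ m j) (hp : ∑ j, p ^ m j = 1) (k : ℕ) :
    ∃ (I : Type) (_ : Fintype I) (b : I → E) (l : I → ℕ),
      F = (⋃ i, (fun x => b i + (Φ ^ (-(l i : ℤ)) : E ≃ₗ[ℝ] E) x) '' F) ∧
      (∀ i, k ≤ l i) ∧ ∑ i, p ^ l i = 1 := by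
  induction k with
  | zero => exact ⟨J, inferInstance, a, m, hF, fun _ => Nat.zero_le _, hp⟩
  | succ k ih =>
    obtain ⟨I, _, b, l, hI, hl, hsum⟩ := ih
    refine ⟨J × I, inferInstance,
      fun q => a q.1 + (Φ ^ (-(m q.1 : ℤ)) : E ≃ₗ[ℝ] E) (b q.2), fun q => m q.1 + l q.2,
      ?_, fun q => ?_, ?_⟩
    · have hcomp : ∀ j i x, a j + (Φ ^ (-(m j : ℤ)) : E ≃ₗ[ℝ] E) (b i) +
          (Φ ^ (-((m j + l i : ℕ) : ℤ)) : E ≃ₗ[ℝ] E) x =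
          a j + (Φ ^ (-(m j : ℤ)) : E ≃ₗ[ℝ] E) (b i + (Φ ^ (-(l i : ℤ)) : E ≃ₗ[ℝ] E) x) := by
        intro j i x
        rw [Nat.cast_add, neg_add, zpow_add, LinearEquiv.mul_apply, map_add, add_assoc]
      ext x
      simp only [Set.mem_iUnion, Set.mem_image, Prod.exists, hcomp]
      constructor
      · intro hx
        rw [hF] at hx
        obtain ⟨j, y, hy, rfl⟩ := Set.mem_iUnion.1 hx
        rw [hI] at hy
        obtain ⟨i, z, hz, rfl⟩ := Set.mem_iUnion.1 hy
        exact ⟨j, i, z, hz, rfl⟩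
      · rintro ⟨j, i, z, hz, rfl⟩
        have hy : b i + (Φ ^ (-(l i : ℤ)) : E ≃ₗ[ℝ] E) z ∈ F := by
          rw [hI]; exact Set.mem_iUnion.2 ⟨i, z, hz, rfl⟩
        rw [hF]
        exact Set.mem_iUnion.2 ⟨j, _, hy, rfl⟩
    · have := hm q.1
      have := hl q.2
      change k + 1 ≤ m q.1 + l q.2
      omega
    · simp_rw [Fintype.sum_prod_type, pow_add]
      rw [← Finset.sum_mul_sum, hp, hsum, one_mul]

/-- The sum is continuous in the exponent, so the strict inequality at `n` persists slightly to the
left. -/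
theorem exists_rpow_sum_le_one {J : Type*} [Fintype J] {c : J → ℝ} (hc : ∀ j, 0 < c j) {n : ℝ}
    (hn : 0 < n) (h : ∑ j, c j ^ n < 1) : ∃ s : ℝ≥0, (s : ℝ) < n ∧ ∑ j, c j ^ (s : ℝ) ≤ 1 := by
  have hcont : Continuous fun s : ℝ => ∑ j, c j ^ s :=
    continuous_finsetSum _ fun j _ => Real.continuous_const_rpow (hc j).ne'
  have h1 : ∀ᶠ s in 𝓝[<] n, ∑ j, c j ^ s < 1 :=
    (hcont.continuousAt.eventually (Iio_mem_nhds h)).filter_mono nhdsWithin_le_nhds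
  have h2 : ∀ᶠ s in 𝓝[<] n, s ∈ Set.Ioo 0 n := Ioo_mem_nhdsLT hn
  obtain ⟨s, hs1, hs2⟩ := (h1.and h2).exists
  exact ⟨⟨s, hs2.1.le⟩, hs2.2, hs1.le⟩

/-- If a compact set with interior points is the union of copies of itself, scaled in such a way
that their similarity dimension is `n`, then its boundary has Hausdorff dimension below `n`. -/
theorem dimH_frontier_lt_of_subdivision {E : Type*} [NormedAddCommGroup E] [NormedSpace ℝ E]
    [FiniteDimensional ℝ E] {N : Seminorm ℝ E} (hN : ∀ x, N x = 0 → x = 0) {Φ : E ≃ₗ[ℝ] E}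
    {ρ : ℝ} (hρ : 1 < ρ) (hΦ : ∀ x, N (Φ x) = ρ * N x) {F : Set E} (hFc : IsCompact F)
    (hFi : (interior F).Nonempty) {J : Type} [Fintype J] (a : J → E) (m : J → ℕ)
    (hF : F = ⋃ j, (fun x => a j + (Φ ^ (-(m j : ℤ)) : E ≃ₗ[ℝ] E) x) '' F)
    (hm : ∀ j, 1 ≤ m j) {n : ℕ} (hn : 1 ≤ n) (hp : ∑ j, ((ρ ^ n)⁻¹) ^ m j = 1) :
    dimH (frontier F) < n := by
  classical
  have hρ0 : 0 < ρ := one_pos.trans hρ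
  obtain ⟨C, hC, hNC⟩ := N.exists_norm_le_mul hN
  obtain ⟨M₀, hM₀⟩ := (hFc.image N.continuous_of_finiteDimensional).bddAbove
  have hFM : ∀ x ∈ F, ∀ y ∈ F, N (x - y) ≤ M₀ + M₀ := fun x hx y hy =>
    (map_sub_le_add N x y).trans
      (add_le_add (hM₀ ⟨x, hx, rfl⟩) (hM₀ ⟨y, hy, rfl⟩))
  obtain ⟨x₀, hx₀⟩ := hFi
  have hM0 : 0 ≤ M₀ + M₀ := (apply_nonneg N _).trans
    (hFM x₀ (interior_subset hx₀) x₀ (interior_subset hx₀))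
  obtain ⟨ε, hε, hball⟩ := Metric.isOpen_iff.1 isOpen_interior x₀ hx₀
  have hinv : ρ⁻¹ < 1 := inv_lt_one_of_one_lt₀ hρ
  -- Pieces of level at least `k` have diameter below `ε`; `1 ≤ k` keeps every ratio at most `ρ⁻¹`.
  obtain ⟨k, hk1, hk⟩ : ∃ k : ℕ, 1 ≤ k ∧ C * (ρ⁻¹ ^ k * (M₀ + M₀)) < ε := by
    have h := ((tendsto_pow_atTop_nhds_zero_of_lt_one (inv_pos.2 hρ0).le hinv).mul_const
      (M₀ + M₀)).const_mul C
    rw [zero_mul, mul_zero] at h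
    exact ((eventually_ge_atTop 1).and (h.eventually (Iio_mem_nhds hε))).exists
  obtain ⟨I, _, b, l, hI, hl, hsum⟩ := exists_iterated_subdivision Φ a m hF hm hp k
  set g : I → E → E := fun i x => b i + (Φ ^ (-(l i : ℤ)) : E ≃ₗ[ℝ] E) x with hg
  have hgN : ∀ i x y, N (g i x - g i y) = ρ⁻¹ ^ l i * N (x - y) := by
    intro i x y
    simp only [hg]
    rw [add_sub_add_left_eq_sub, ← map_sub, Seminorm.apply_zpow_of_similarity hρ0 hΦ, zpow_neg,
      zpow_natCast, inv_pow]
  have hgF : ∀ i, g i '' F ⊆ F := fun i => by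
    conv_rhs => rw [hI]
    exact Set.subset_iUnion (fun i => g i '' F) i
  have hgopen : ∀ i, IsOpenMap (g i) := fun i =>
    (isOpenMap_add_left (b i)).comp
      (Φ ^ (-(l i : ℤ)) : E ≃ₗ[ℝ] E).toContinuousLinearEquiv.toHomeomorph.isOpenMap
  have hgint : ∀ i, g i '' interior F ⊆ interior F := fun i =>
    interior_maximal ((Set.image_mono interior_subset).trans (hgF i))
      (hgopen i _ isOpen_interior)
  -- A piece containing `x₀` is small enough to stay inside the ball around it.
  obtain ⟨i₀, hi₀⟩ : ∃ i₀, g i₀ '' F ⊆ interior F := by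
    have hx : x₀ ∈ ⋃ i, g i '' F := by rw [← hI]; exact interior_subset hx₀
    obtain ⟨i, y₀, hy₀, hy⟩ := Set.mem_iUnion.1 hx
    refine ⟨i, ?_⟩
    rintro _ ⟨y, hyF, rfl⟩
    refine hball ?_
    rw [Metric.mem_ball, dist_eq_norm, ← hy]
    refine lt_of_le_of_lt ((hNC _).trans (mul_le_mul_of_nonneg_left ?_ hC.le)) hk
    rw [hgN]
    exact mul_le_mul (pow_le_pow_of_le_one (inv_pos.2 hρ0).le hinv.le (hl i))
      (hFM y hyF y₀ hy₀) (apply_nonneg N _) (pow_nonneg (inv_pos.2 hρ0).le _)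
  have hfr : frontier F ⊆ F := hFc.isClosed.frontier_subset
  -- A boundary point lies neither in the piece `i₀` nor in the image of an interior point, so its
  -- preimage in another piece is a boundary point.
  have hcov : frontier F ⊆ ⋃ i : {i // i ≠ i₀}, g i '' frontier F := by
    intro x hx
    have hx' : x ∈ ⋃ i, g i '' F := by rw [← hI]; exact hfr hx
    obtain ⟨i, y, hy, rfl⟩ := Set.mem_iUnion.1 hx'
    have hni : g i y ∉ interior F := hx.2
    refine Set.mem_iUnion.2 ⟨⟨i, ?_⟩, y, ⟨subset_closure hy, fun h => hni ?_⟩, rfl⟩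
    · rintro rfl
      exact hni (hi₀ ⟨y, hy, rfl⟩)
    · exact hgint i ⟨y, h, rfl⟩
  have hlt : ∑ i : {i // i ≠ i₀}, (ρ⁻¹ ^ l i) ^ (n : ℝ) < 1 := by
    have hterm : ∀ i, (ρ⁻¹ ^ l i) ^ (n : ℝ) = ((ρ ^ n)⁻¹) ^ l i := fun i => by
      rw [Real.rpow_natCast, ← inv_pow, ← pow_mul, ← pow_mul, mul_comm]
    simp_rw [hterm]
    rw [← hsum, ← Finset.sum_subtype (Finset.univ.erase i₀) (by simp)
      (fun i => ((ρ ^ n)⁻¹) ^ l i), ← Finset.add_sum_erase _ _ (Finset.mem_univ i₀)]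
    have : 0 < ((ρ ^ n)⁻¹) ^ l i₀ := by positivity
    linarith
  obtain ⟨s, hsn, hs⟩ := exists_rpow_sum_le_one (c := fun i : {i // i ≠ i₀} => ρ⁻¹ ^ l i)
    (fun i => by positivity) (by exact_mod_cast hn) hlt
  have hdim : dimH (frontier F) ≤ s :=
    dimH_le_of_subset_iUnion_image N hC hNC (fun i : {i // i ≠ i₀} => g i)
      (fun i => ρ⁻¹ ^ l i) (l := ρ⁻¹) (fun i => by positivity) (by positivity) hinv
      (fun i => pow_le_of_le_one (inv_pos.2 hρ0).le hinv.le
        (by have := hl i; omega))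
      (fun i => hgN i) hcov hM0 (fun x hx y hy => hFM x (hfr hx) y (hfr hy)) hs
  refine hdim.trans_lt ?_
  have : s < (n : ℝ≥0) := by exact_mod_cast hsn
  exact_mod_cast ENNReal.coe_lt_coe.2 this

end SelfSimilar

/-! ### Width-`w` non-adjacent forms -/

section WNAF

variable {E : Type*} [Zero E] {w : ℕ} {D : Set E} {η : ℤ → E}

/-- This pairwise form makes each condition involve two coordinates only, hence closed in the
product topology. -/
theorem isWNAF_iff :
    IsWNAF w D η ↔ (∀ j, η j ∈ D) ∧ ∀ i j : ℤ, i < j → j < i + w → η i = 0 ∨ η j = 0 := by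
  refine and_congr_right fun _ => ⟨fun h i j hij hjw => ?_, fun h j x hx y hy => ?_⟩
  · by_contra! hne
    have := h i (x := i) ⟨⟨le_rfl, by omega⟩, hne.1⟩ (y := j) ⟨⟨hij.le, by omega⟩, hne.2⟩
    omega
  · obtain ⟨⟨hx1, hx2⟩, hx⟩ := hx
    obtain ⟨⟨hy1, hy2⟩, hy⟩ := hy
    rcases lt_trichotomy x y with hxy | hxy | hxy
    · rcases h x y hxy (by omega) with h0 | h0 <;> contradiction
    · exact hxy
    · rcases h y x hxy (by omega) with h0 | h0 <;> contradiction

theorem IsWNAF.shift (h : IsWNAF w D η) (m : ℤ) : IsWNAF w D fun j => η (j - m) := by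
  rw [isWNAF_iff] at h ⊢
  exact ⟨fun j => h.1 _, fun i j hij hjw => h.2 _ _ (by omega) (by omega)⟩

theorem isWNAF_zero (h0 : (0 : E) ∈ D) : IsWNAF w D (0 : ℤ → E) :=
  isWNAF_iff.2 ⟨fun _ => h0, fun _ _ _ _ => Or.inl rfl⟩

/-- Replacing digits by zeros preserves the non-adjacency. -/
theorem IsWNAF.ite (h0 : (0 : E) ∈ D) (h : IsWNAF w D η) (P : ℤ → Prop) [DecidablePred P] :
    IsWNAF w D fun j => if P j then η j else 0 := by
  rw [isWNAF_iff] at h ⊢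
  refine ⟨fun j => ?_, fun i j hij hjw => ?_⟩
  · by_cases hj : P j <;> simp [hj, h0, h.1]
  · rcases h.2 i j hij hjw with h' | h' <;> simp [h']

/-- A digit can be inserted where it is surrounded by sufficiently many zeros. -/
theorem IsWNAF.update (h : IsWNAF w D η) {p : ℤ} {d : E} (hd : d ∈ D)
    (hp : ∀ j, p - w < j → j < p + w → η j = 0) : IsWNAF w D (Function.update η p d) := by
  rw [isWNAF_iff] at h ⊢
  refine ⟨fun j => ?_, fun i j hij hjw => ?_⟩
  · rcases eq_or_ne j p with rfl | hj
    · simpa using hd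
    · simpa [hj] using h.1 j
  · rcases eq_or_ne i p with rfl | hi
    · right
      rw [Function.update_of_ne hij.ne']
      exact hp j (by omega) hjw
    rcases eq_or_ne j p with rfl | hj
    · left
      rw [Function.update_of_ne hi]
      exact hp i (by omega) (by omega)
    rw [Function.update_of_ne hi, Function.update_of_ne hj]
    exact h.2 i j hij hjw

end WNAF

/-! ### Values of non-adjacent forms -/

section Value

variable {E : Type*} [NormedAddCommGroup E] [NormedSpace ℝ E] {w : ℕ} {D : Set E} {η : ℤ → E}
  {Φ : E ≃ₗ[ℝ] E}

theorem wnafValue_shift [FiniteDimensional ℝ E] (η : ℤ → E) (m : ℤ) :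
    wnafValue Φ (fun j => η (j - m)) = (Φ ^ m : E ≃ₗ[ℝ] E) (wnafValue Φ η) := by
  unfold wnafValue
  have h := (Φ ^ m : E ≃ₗ[ℝ] E).toContinuousLinearEquiv.map_tsum
    (f := fun j : ℤ => (Φ ^ j : E ≃ₗ[ℝ] E) (η j)) (L := .unconditional ℤ)
  simp only [LinearEquiv.coe_toContinuousLinearEquiv'] at h
  rw [h, ← (Equiv.addRight m).tsum_eq]
  refine tsum_congr fun j => ?_
  simp only [Equiv.coe_addRight, add_sub_cancel_right]
  rw [add_comm, zpow_add, LinearEquiv.mul_apply]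

theorem wnafValue_update (hs : Summable fun j : ℤ => (Φ ^ j : E ≃ₗ[ℝ] E) (η j)) {p : ℤ} {d : E}
    (hp : η p = 0) :
    wnafValue Φ (Function.update η p d) = (Φ ^ p : E ≃ₗ[ℝ] E) d + wnafValue Φ η := by
  have hfun : (fun j : ℤ => (Φ ^ j : E ≃ₗ[ℝ] E) (Function.update η p d j)) =
      fun j => (Pi.single p ((Φ ^ p : E ≃ₗ[ℝ] E) d) : ℤ → E) j + (Φ ^ j : E ≃ₗ[ℝ] E) (η j) := by
    funext j
    rcases eq_or_ne j p with rfl | hj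
    · simp [hp]
    · simp [hj]
  have hs' : HasSum (Pi.single p ((Φ ^ p : E ≃ₗ[ℝ] E) d) : ℤ → E) ((Φ ^ p : E ≃ₗ[ℝ] E) d) :=
    hasSum_pi_single p _
  unfold wnafValue
  rw [hfun]
  exact (hs'.add hs.hasSum).tsum_eq

theorem summable_inv_pow_natAbs {ρ : ℝ} (hρ : 1 < ρ) :
    Summable fun j : ℤ => ρ⁻¹ ^ j.natAbs := by
  have h : Summable fun k : ℕ => ρ⁻¹ ^ k :=
    summable_geometric_of_lt_one (inv_pos.2 (one_pos.trans hρ)).le (inv_lt_one_of_one_lt₀ hρ)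
  exact Summable.of_nat_of_neg (by simpa using h) (by simpa using h)

variable {N : Seminorm ℝ E} {ρ C M : ℝ}

theorem norm_zpow_apply_le (hρ : 1 < ρ) (hΦ : ∀ x, N (Φ x) = ρ * N x)
    (hC : 0 < C) (hNC : ∀ x, ‖x‖ ≤ C * N x) (hM0 : 0 ≤ M) {K : ℕ} {j : ℤ} {x : E} (hM : N x ≤ M)
    (hK : (K : ℤ) ≤ j → x = 0) :
    ‖(Φ ^ j : E ≃ₗ[ℝ] E) x‖ ≤ C * M * ρ ^ (2 * K) * ρ⁻¹ ^ j.natAbs := by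
  have hρ0 : 0 < ρ := one_pos.trans hρ
  by_cases hj : (K : ℤ) ≤ j
  · rw [hK hj, map_zero, norm_zero]
    positivity
  -- Here `j < K`, so j + |j| ≤ 2K; the factor ρ^(2K) pays for the finitely many non-negative
  -- exponents.
  have hle : ρ ^ j ≤ ρ ^ (2 * K) * ρ⁻¹ ^ j.natAbs := by
    rw [← zpow_natCast, ← zpow_natCast, inv_zpow', ← zpow_add₀ hρ0.ne']
    exact zpow_le_zpow_right₀ hρ.le (by omega)
  calc ‖(Φ ^ j : E ≃ₗ[ℝ] E) x‖ ≤ C * (ρ ^ j * N x) := by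
        rw [← Seminorm.apply_zpow_of_similarity hρ0 hΦ]; exact hNC _
    _ ≤ C * (ρ ^ (2 * K) * ρ⁻¹ ^ j.natAbs * M) := by gcongr
    _ = C * M * ρ ^ (2 * K) * ρ⁻¹ ^ j.natAbs := by ring

theorem Set.Finite.exists_seminorm_le (hDf : D.Finite) (N : Seminorm ℝ E) :
    ∃ M : ℝ, 0 ≤ M ∧ ∀ x ∈ D, N x ≤ M := by
  obtain ⟨M, hM⟩ := (hDf.image N).bddAbove
  exact ⟨max M 0, le_max_right _ _, fun x hx => (hM ⟨x, hx, rfl⟩).trans (le_max_left _ _)⟩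

variable [FiniteDimensional ℝ E]

theorem summable_wnaf (hN : ∀ x, N x = 0 → x = 0) (hρ : 1 < ρ) (hΦ : ∀ x, N (Φ x) = ρ * N x)
    (hDf : D.Finite) (hη : ∀ j, η j ∈ D) {K : ℕ} (hK : ∀ j : ℤ, K ≤ j → η j = 0) :
    Summable fun j : ℤ => (Φ ^ j : E ≃ₗ[ℝ] E) (η j) := by
  obtain ⟨C, hC, hNC⟩ := N.exists_norm_le_mul hN
  obtain ⟨M, hM0, hM⟩ := hDf.exists_seminorm_le N
  exact Summable.of_norm_bounded ((summable_inv_pow_natAbs hρ).mul_left _) fun j =>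
    norm_zpow_apply_le hρ hΦ hC hNC hM0 (hM _ (hη j)) (hK j)

/-- The admissible sequences form a closed subset of a product of finite sets, and the value is
continuous there by the Weierstrass M-test. -/
theorem isCompact_fundamentalDomain (hN : ∀ x, N x = 0 → x = 0) (hρ : 1 < ρ)
    (hΦ : ∀ x, N (Φ x) = ρ * N x) (hDf : D.Finite) : IsCompact (fundamentalDomain Φ w D) := by
  obtain ⟨C, hC, hNC⟩ := N.exists_norm_le_mul hN
  obtain ⟨M, hM0, hM⟩ := hDf.exists_seminorm_le N
  refine IsCompact.image_of_continuousOn ?_ ?_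
  · have hset : {η : ℤ → E | IsWNAF w D η ∧ ∀ j : ℤ, 0 ≤ j → η j = 0} =
        Set.univ.pi (fun _ => D) ∩
          ({η | ∀ i j : ℤ, i < j → j < i + w → η i = 0 ∨ η j = 0} ∩
            {η | ∀ j : ℤ, 0 ≤ j → η j = 0}) := by
      ext η
      simp only [isWNAF_iff, Set.mem_ofPred_eq, Set.mem_inter_iff, Set.mem_univ_pi, and_assoc]
    rw [hset]
    refine (isCompact_univ_pi fun _ => hDf.isCompact).inter_right (IsClosed.inter ?_ ?_)
    · simp only [Set.ofPred_forall]
      refine isClosed_iInter fun i => isClosed_iInter fun j => isClosed_iInter fun _ =>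
        isClosed_iInter fun _ => ?_
      exact (isClosed_eq (continuous_apply i) continuous_const).union
        (isClosed_eq (continuous_apply j) continuous_const)
    · simp only [Set.ofPred_forall]
      exact isClosed_iInter fun j => isClosed_iInter fun _ =>
        isClosed_eq (continuous_apply j) continuous_const
  · unfold wnafValue
    refine continuousOn_tsum (fun j => ?_) ((summable_inv_pow_natAbs hρ).mul_left _)
      fun j η hη => norm_zpow_apply_le hρ hΦ hC hNC hM0 (K := 0) (hM _ (hη.1.1 j))
        (fun hj => hη.2 j (by exact_mod_cast hj))
    exact ((Φ ^ j : E ≃ₗ[ℝ] E).toContinuousLinearEquiv.continuous.comp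
      (continuous_apply j)).continuousOn

/-- The fundamental domain consists of the forms with leading digit `0` and, for each non-zero
digit `d`, the forms with leading digit `d`, followed by `w - 1` zeros. -/
theorem fundamentalDomain_eq_iUnion (hN : ∀ x, N x = 0 → x = 0) (hρ : 1 < ρ)
    (hΦ : ∀ x, N (Φ x) = ρ * N x) (hDf : D.Finite) (h0 : (0 : E) ∈ D) (hw : 1 ≤ w) :
    fundamentalDomain Φ w D = ⋃ o : Option {d // d ∈ D ∧ d ≠ 0},
      (fun x => o.elim 0 (fun d => (Φ ^ (-1 : ℤ) : E ≃ₗ[ℝ] E) d) +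
        (Φ ^ (-((o.elim 1 fun _ => w : ℕ) : ℤ)) : E ≃ₗ[ℝ] E) x) '' fundamentalDomain Φ w D := by
  ext x
  rw [Set.mem_iUnion]
  constructor
  · rintro ⟨η, ⟨hη, hη0⟩, rfl⟩
    by_cases h1 : η (-1) = 0
    · refine ⟨none, wnafValue Φ (fun j => η (j - 1)), ⟨_, ⟨hη.shift 1, fun j hj => ?_⟩, rfl⟩, ?_⟩
      · rcases hj.eq_or_lt with rfl | hj
        · simpa using h1
        · exact hη0 _ (by omega)
      · simp only [Option.elim_none, zero_add, Nat.cast_one]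
        rw [wnafValue_shift, ← LinearEquiv.mul_apply, ← zpow_add]
        simp
    · set η₀ : ℤ → E := fun j => if j ≠ -1 then η j else 0 with hη₀
      have hη₀w : IsWNAF w D η₀ := hη.ite h0 _
      have hη₀z : ∀ j : ℤ, 0 ≤ j → η₀ j = 0 := fun j hj => by simp [hη₀, hη0 j hj]
      have hval : wnafValue Φ η = (Φ ^ (-1 : ℤ) : E ≃ₗ[ℝ] E) (η (-1)) + wnafValue Φ η₀ := by
        rw [← wnafValue_update (summable_wnaf hN hρ hΦ hDf hη₀w.1 (K := 0) (by simpa using hη₀z))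
          (by simp [hη₀])]
        congr 1
        funext j
        rcases eq_or_ne j (-1) with rfl | hj
        · simp
        · simp [hη₀, hj]
      refine ⟨some ⟨η (-1), hη.1 _, h1⟩, wnafValue Φ (fun j => η₀ (j - w)),
        ⟨_, ⟨hη₀w.shift w, fun j hj => ?_⟩, rfl⟩, ?_⟩
      -- The digits at -w, …, -2 vanish because they are close to the non-zero digit at -1, which
      -- itself has been cleared; hence a shift by `w` leaves no integer part.
      · by_cases hj1 : j - w < -1
        · rcases (isWNAF_iff.1 hη).2 (j - w) (-1) hj1 (by omega) with h | h
          · simp [hη₀, h]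
          · exact absurd h h1
        · rcases eq_or_ne (j - w) (-1) with hj2 | hj2
          · simp [hη₀, hj2]
          · exact hη₀z _ (by omega)
      · simp only [Option.elim_some]
        rw [wnafValue_shift, ← LinearEquiv.mul_apply, ← zpow_add, hval]
        simp
  · rintro ⟨o, _, ⟨η, ⟨hη, hη0⟩, rfl⟩, rfl⟩
    cases o with
    | none =>
      refine ⟨fun j => η (j - (-1)), ⟨hη.shift _, fun j hj => hη0 _ (by omega)⟩, ?_⟩
      rw [wnafValue_shift]
      simp
    | some d =>
      have hz' : ∀ j : ℤ, -w ≤ j → η (j - (-w)) = 0 := fun j hj => hη0 _ (by omega)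
      have hsh := hη.shift (-(w : ℤ))
      refine ⟨Function.update (fun j => η (j - (-w))) (-1) d,
        ⟨hsh.update d.2.1 fun j h1 h2 => hz' j (by omega), fun j hj => ?_⟩, ?_⟩
      · rw [Function.update_of_ne (by omega)]
        exact hz' j (by omega)
      · rw [wnafValue_update (summable_wnaf hN hρ hΦ hDf hsh.1 (K := 0)
          (fun j hj => hz' j (by omega))) (hz' _ (by omega)), wnafValue_shift]
        simp

end Value

/-! ### Non-adjacent forms of lattice points -/

section Lattice

variable {E : Type*} [NormedAddCommGroup E] [NormedSpace ℝ E] [FiniteDimensional ℝ E]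
  {w : ℕ} {D : Set E} {Φ : E ≃ₗ[ℝ] E} {N : Seminorm ℝ E} {ρ : ℝ} {Λ : Submodule ℤ E}

theorem isClosed_of_discreteTopology {E : Type*} [NormedAddCommGroup E] (Λ : Submodule ℤ E) [DiscreteTopology Λ] :
    IsClosed (Λ : Set E) := by
  have : DiscreteTopology Λ.toAddSubgroup := ‹DiscreteTopology Λ›
  exact AddSubgroup.isClosed_of_discrete (H := Λ.toAddSubgroup)

theorem finite_setOf_seminorm_lt (Λ : Submodule ℤ E) [DiscreteTopology Λ]
    (hN : ∀ x, N x = 0 → x = 0) (c : ℝ) : {y | y ∈ Λ ∧ N y < c}.Finite := by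
  have : ProperSpace E := FiniteDimensional.proper_real E
  obtain ⟨C, hC, hNC⟩ := N.exists_norm_le_mul hN
  refine (Metric.finite_isBounded_inter_isClosed (DiscreteTopology.isDiscrete (s := (Λ : Set E)))
    (Metric.isBounded_closedBall (x := (0 : E)) (r := C * c))
    (isClosed_of_discreteTopology Λ)).subset ?_
  rintro y ⟨hy, hyc⟩
  refine ⟨?_, hy⟩
  rw [mem_closedBall_zero_iff]
  exact (hNC y).trans (mul_le_mul_of_nonneg_left hyc.le hC.le)

theorem pow_mem_of_forall_mem {E : Type*} [AddCommGroup E] [Module ℝ E] {Φ : E ≃ₗ[ℝ] E}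
    {Λ : Submodule ℤ E} (hΦΛ : ∀ x ∈ Λ, Φ x ∈ Λ) (k : ℕ) {x : E} (hx : x ∈ Λ) :
    (Φ ^ k : E ≃ₗ[ℝ] E) x ∈ Λ := by
  induction k with
  | zero => simpa using hx
  | succ k ih => rw [pow_succ', LinearEquiv.mul_apply]; exact hΦΛ _ ih

/-- Stripping off the least significant digit makes a lattice point smaller. -/
theorem seminorm_lt_of_tilesBy (hΦ : ∀ x, N (Φ x) = ρ * N x)
    {T : Set E} (hT : TilesBy Λ T) {r R : ℝ} (hr : 0 < r)
    (hrT : {x | N x ≤ r} ⊆ T) (hTR : T ⊆ {x | N x ≤ R}) (hrR : R / r < ρ ^ w - 1)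
    {e y : E} (he : e ∈ T) (hy : y ∈ Λ) (hy0 : y ≠ 0) :
    N y < N ((Φ ^ w : E ≃ₗ[ℝ] E) (y + e)) := by
  rw [Seminorm.apply_pow_of_similarity hΦ]
  -- If N (y + e) < r, this point would be interior to `T`, yet it lies in T ∩ (y + T), which is
  -- contained in the boundary.
  have hu : r ≤ N (y + e) := by
    by_contra! hlt
    have hint : y + e ∈ interior T := by
      refine interior_maximal (fun x (hx : N x < r) => hrT hx.le) ?_ hlt
      exact isOpen_lt N.continuous_of_finiteDimensional continuous_const
    exact (hT.2 y hy hy0 ⟨interior_subset hint, e, he, rfl⟩).2 hint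
  have heR : N e ≤ R := hTR he
  have h1 : N y ≤ N (y + e) + N e := by
    simpa using map_sub_le_add N (y + e) e
  rw [div_lt_iff₀ hr] at hrR
  have hpos : 0 < ρ ^ w - 1 := by
    have : 0 ≤ R := (apply_nonneg N e).trans heR
    nlinarith
  -- With u = N (y + e) ≥ r: N y ≤ u + R < u + (ρʷ - 1) r ≤ ρʷ u.
  nlinarith [mul_le_mul_of_nonneg_left hu hpos.le]

/-- Induction on the finite number of lattice points of smaller norm. Either z = Φ y, or z = d + Φʷ
y with a digit `d`; in both cases a non-zero `y` is strictly smaller than `z`. -/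
theorem exists_finite_wnaf [DiscreteTopology Λ] (hN : ∀ x, N x = 0 → x = 0) (hρ : 1 < ρ)
    (hΦ : ∀ x, N (Φ x) = ρ * N x)
    {T : Set E} (hT : TilesBy Λ T) {r R : ℝ} (hr : 0 < r)
    (hrT : {x | N x ≤ r} ⊆ T) (hTR : T ⊆ {x | N x ≤ R}) (hw : 1 ≤ w) (hrR : R / r < ρ ^ w - 1)
    (hD : IsReducedResidueDigitSet Λ Φ w D) (hDf : D.Finite)
    (hDT : D ⊆ (Φ ^ w : E ≃ₗ[ℝ] E) '' T) {z : E} (hz : z ∈ Λ) :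
    ∃ η, IsWNAF w D η ∧ (∀ j < 0, η j = 0) ∧ (∃ K : ℕ, ∀ j : ℤ, K ≤ j → η j = 0) ∧
      wnafValue Φ η = z := by
  induction hk : {y | y ∈ Λ ∧ N y < N z}.ncard using Nat.strong_induction_on generalizing z with
  | _ k ih =>
  have hzero : ∃ η, IsWNAF w D η ∧ (∀ j < 0, η j = 0) ∧ (∃ K : ℕ, ∀ j : ℤ, K ≤ j → η j = 0) ∧
      wnafValue Φ η = 0 :=
    ⟨0, isWNAF_zero hD.zero_mem, by simp, by simp, by simp [wnafValue]⟩
  have hrec : ∀ y ∈ Λ, N y < N z → ∃ η, IsWNAF w D η ∧ (∀ j < 0, η j = 0) ∧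
      (∃ K : ℕ, ∀ j : ℤ, K ≤ j → η j = 0) ∧ wnafValue Φ η = y := by
    intro y hy hyz
    refine ih _ ?_ hy rfl
    rw [← hk]
    refine Set.ncard_lt_ncard ⟨fun x hx => ⟨hx.1, hx.2.trans hyz⟩, fun hsub => ?_⟩
      (finite_setOf_seminorm_lt Λ hN _)
    exact lt_irrefl _ (hsub ⟨hy, hyz⟩).2
  rcases eq_or_ne z 0 with rfl | hz0
  · exact hzero
  by_cases hzΦ : z ∈ Φ '' Λ
  · obtain ⟨y, hy, rfl⟩ := hzΦ
    have hy0 : y ≠ 0 := by rintro rfl; simp at hz0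
    have hNy : 0 < N y := lt_of_le_of_ne (apply_nonneg N y) fun h => hy0 (hN y h.symm)
    obtain ⟨η, hη, hη0, ⟨K, hK⟩, hval⟩ := hrec y hy (by rw [hΦ]; nlinarith)
    refine ⟨fun j => η (j - 1), hη.shift 1, fun j hj => hη0 _ (by omega),
      ⟨K + 1, fun j hj => hK _ (by push_cast at hj; omega)⟩, ?_⟩
    rw [wnafValue_shift, hval, zpow_one]
  · obtain ⟨d, ⟨hd, y, hy, hyd⟩, -⟩ := hD.existsUnique z hz hzΦ
    obtain ⟨e, he, hed⟩ := hDT hd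
    have hzd : z = d + (Φ ^ w : E ≃ₗ[ℝ] E) y := by rw [hyd]; abel
    obtain ⟨η, hη, hη0, ⟨K, hK⟩, hval⟩ : ∃ η, IsWNAF w D η ∧ (∀ j < 0, η j = 0) ∧
        (∃ K : ℕ, ∀ j : ℤ, K ≤ j → η j = 0) ∧ wnafValue Φ η = y := by
      rcases eq_or_ne y 0 with rfl | hy0
      · exact hzero
      refine hrec y hy ?_
      have := seminorm_lt_of_tilesBy hΦ hT hr hrT hTR hrR he hy hy0
      rwa [map_add, hed, add_comm, ← hzd] at this
    -- The shift empties the positions 0, …, w - 1, so `d` can be placed at 0.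
    have hsh := hη.shift w
    refine ⟨Function.update (fun j => η (j - w)) 0 d,
      hsh.update hd fun j _ h2 => hη0 _ (by omega), fun j hj => ?_,
      ⟨K + w, fun j hj => ?_⟩, ?_⟩
    · rw [Function.update_of_ne (by omega)]
      exact hη0 _ (by omega)
    · push_cast at hj
      rw [Function.update_of_ne (by omega)]
      exact hK _ (by omega)
    · rw [wnafValue_update (summable_wnaf hN hρ hΦ hDf hsh.1 (K := K + w)
        (fun j hj => hK _ (by push_cast at hj; omega))) (hη0 _ (by omega)), wnafValue_shift,
        hval, hzd]
      simp

/-- Splitting a form into its integer part and its fractional part. -/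
theorem wnafValue_mem_add (hN : ∀ x, N x = 0 → x = 0) (hρ : 1 < ρ)
    (hΦ : ∀ x, N (Φ x) = ρ * N x) (hΦΛ : ∀ x ∈ Λ, Φ x ∈ Λ) (hDΛ : D ⊆ Λ) (h0 : (0 : E) ∈ D)
    (hDf : D.Finite) {η : ℤ → E} (hη : IsWNAF w D η) {K : ℕ} (hK : ∀ j : ℤ, K ≤ j → η j = 0) :
    ∃ y ∈ Λ, ∃ x ∈ fundamentalDomain Φ w D, wnafValue Φ η = y + x := by
  have hi : IsWNAF w D fun j => if 0 ≤ j then η j else 0 := hη.ite h0 _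
  have hf : IsWNAF w D fun j => if j < 0 then η j else 0 := hη.ite h0 _
  refine ⟨wnafValue Φ fun j => if 0 ≤ j then η j else 0, ?_,
    wnafValue Φ fun j => if j < 0 then η j else 0, ⟨_, ⟨hf, fun j hj => if_neg hj.not_gt⟩, rfl⟩, ?_⟩
  · unfold wnafValue
    rw [tsum_eq_sum (s := Finset.Ico 0 (K : ℤ))]
    · refine Submodule.sum_mem _ fun j hj => ?_
      obtain ⟨k, rfl⟩ := Int.eq_ofNat_of_zero_le (Finset.mem_Ico.1 hj).1
      rw [zpow_natCast]
      exact pow_mem_of_forall_mem hΦΛ k (hDΛ (hi.1 _))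
    · intro j hj
      rw [Finset.mem_Ico] at hj
      simp only
      by_cases h : 0 ≤ j
      · rw [if_pos h, hK j (by omega), map_zero]
      · rw [if_neg h, map_zero]
  · have h1 := summable_wnaf hN hρ hΦ hDf hi.1 (K := K) (fun j hj => by simp [hK j hj])
    have h2 := summable_wnaf hN hρ hΦ hDf hf.1 (K := K) (fun j hj => by simp [hK j hj])
    unfold wnafValue
    rw [← h1.tsum_add h2]
    refine tsum_congr fun j => ?_
    by_cases h : 0 ≤ j
    · simp [h]
    · simp [h, not_le.1 h]

/-- Write Φᵏx = z + t with z ∈ Λ and t ∈ T. The finite form of `z`, shifted by -k, puts Φ⁻ᵏz in Λ +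
F at `N`-distance at most ρ⁻ᵏR from `x`. A closed set plus a compact one is closed, so `x` belongs
to Λ + F. -/
theorem exists_eq_add_fundamentalDomain [DiscreteTopology Λ] (hN : ∀ x, N x = 0 → x = 0)
    (hρ : 1 < ρ) (hΦ : ∀ x, N (Φ x) = ρ * N x) (hΦΛ : ∀ x ∈ Λ, Φ x ∈ Λ)
    {T : Set E} (hT : TilesBy Λ T) {r R : ℝ} (hr : 0 < r)
    (hrT : {x | N x ≤ r} ⊆ T) (hTR : T ⊆ {x | N x ≤ R}) (hw : 1 ≤ w) (hrR : R / r < ρ ^ w - 1)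
    (hD : IsReducedResidueDigitSet Λ Φ w D) (hDf : D.Finite)
    (hDT : D ⊆ (Φ ^ w : E ≃ₗ[ℝ] E) '' T) (x : E) :
    ∃ y ∈ Λ, ∃ u ∈ fundamentalDomain Φ w D, y + u = x := by
  have hρ0 : 0 < ρ := one_pos.trans hρ
  obtain ⟨C, hC, hNC⟩ := N.exists_norm_le_mul hN
  have hcl : IsClosed ((Λ : Set E) + fundamentalDomain Φ w D) :=
    (isClosed_of_discreteTopology Λ).add_right_of_isCompact
      (isCompact_fundamentalDomain hN hρ hΦ hDf)
  have happrox : ∀ k : ℕ, ∃ v ∈ (Λ : Set E) + fundamentalDomain Φ w D,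
      ‖x - v‖ ≤ C * (ρ⁻¹ ^ k * R) := by
    intro k
    have hmem : (Φ ^ (k : ℤ) : E ≃ₗ[ℝ] E) x ∈ ⋃ z ∈ Λ, (fun x => z + x) '' T := by
      rw [hT.1]; trivial
    obtain ⟨z, hz, t, ht, hzt⟩ := Set.mem_iUnion₂.1 hmem
    obtain ⟨η, hη, -, ⟨K, hK⟩, hval⟩ :=
      exists_finite_wnaf hN hρ hΦ hT hr hrT hTR hw hrR hD hDf hDT hz
    obtain ⟨y, hy, u, hu, hyu⟩ := wnafValue_mem_add hN hρ hΦ hΦΛ hD.subset hD.zero_mem hDf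
      (hη.shift (-(k : ℤ))) (K := K) (fun j hj => hK _ (by omega))
    refine ⟨_, Set.add_mem_add hy hu, ?_⟩
    rw [← hyu, wnafValue_shift, hval]
    have hx : x = (Φ ^ (-(k : ℤ)) : E ≃ₗ[ℝ] E) (z + t) := by
      simp only at hzt
      rw [hzt, ← LinearEquiv.mul_apply, ← zpow_add]
      simp
    rw [hx, map_add, add_sub_cancel_left]
    refine (hNC _).trans (mul_le_mul_of_nonneg_left ?_ hC.le)
    rw [Seminorm.apply_zpow_of_similarity hρ0 hΦ, zpow_neg, zpow_natCast, ← inv_pow]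
    exact mul_le_mul_of_nonneg_left (hTR ht) (by positivity)
  choose v hv hxv using happrox
  have hlim : Tendsto v atTop (𝓝 x) := by
    rw [tendsto_iff_norm_sub_tendsto_zero]
    refine squeeze_zero (fun k => norm_nonneg _) (fun k => ?_) (g := fun k => C * (ρ⁻¹ ^ k * R)) ?_
    · rw [norm_sub_rev]
      exact hxv k
    · have h := ((tendsto_pow_atTop_nhds_zero_of_lt_one (inv_pos.2 hρ0).le
        (inv_lt_one_of_one_lt₀ hρ)).mul_const R).const_mul C
      rwa [zero_mul, mul_zero] at h
  exact Set.mem_add.1 (hcl.mem_of_tendsto hlim (Eventually.of_forall hv))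

/-- Baire's theorem, applied to the countably many closed translates. -/
theorem interior_nonempty_of_forall_exists_add (Λ : Submodule ℤ E) [DiscreteTopology Λ]
    {F : Set E} (hF : IsClosed F) (h : ∀ x, ∃ y ∈ Λ, ∃ u ∈ F, y + u = x) :
    (interior F).Nonempty := by
  have : ProperSpace E := FiniteDimensional.proper_real E
  have : Countable Λ := countable_of_Lindelof_of_discrete
  obtain ⟨y, x, hx⟩ := nonempty_interior_of_iUnion_of_closed
    (f := fun y : Λ => (Homeomorph.addLeft (y : E)) '' F)
    (fun y => (Homeomorph.addLeft (y : E)).isClosedMap _ hF) (by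
      refine Set.eq_univ_of_forall fun x => ?_
      obtain ⟨y, hy, u, hu, rfl⟩ := h x
      exact Set.mem_iUnion.2 ⟨⟨y, hy⟩, u, hu, rfl⟩)
  rw [← Homeomorph.image_interior] at hx
  obtain ⟨u, hu, -⟩ := hx
  exact ⟨u, hu⟩

end Lattice

end

theorem mainTheorem3 (n : ℕ) (hn : 1 ≤ n)
    (Λ : Submodule ℤ (EuclideanSpace ℝ (Fin n))) [DiscreteTopology Λ] [IsZLattice ℝ Λ]
    (Φ : EuclideanSpace ℝ (Fin n) ≃ₗ[ℝ] EuclideanSpace ℝ (Fin n))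
    (hΦΛ : ∀ x ∈ Λ, Φ x ∈ Λ)
    (ρ : ℝ) (hρ : 1 < ρ)
    (heig : ∀ μ : ℂ, Polynomial.aeval μ (LinearMap.charpoly Φ.toLinearMap) = 0 → ‖μ‖ = ρ)
    (hρn : ∃ m : ℕ, ρ ^ n = m)
    (T : Set (EuclideanSpace ℝ (Fin n))) (hT : TilesBy Λ T) (hTclosed : IsClosed T)
    (hTfrontier : MeasureTheory.volume (frontier T) = 0)
    (N : Seminorm ℝ (EuclideanSpace ℝ (Fin n))) (hN : ∀ x, N x = 0 → x = 0)
    (hNΦ : HasInducedNorm N Φ ρ) (hNΦinv : HasInducedNorm N Φ.symm ρ⁻¹)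
    (r R : ℝ) (hr : 0 < r) (hR : 0 < R)
    (hrT : {x | N x ≤ r} ⊆ T) (hTR : T ⊆ {x | N x ≤ R})
    (w : ℕ) (hw : 1 ≤ w) (hrR : R / r < ρ ^ w - 1)
    (D : Set (EuclideanSpace ℝ (Fin n))) (hD : IsReducedResidueDigitSet Λ Φ w D)
    (hDT : D ⊆ (Φ ^ w : EuclideanSpace ℝ (Fin n) ≃ₗ[ℝ] EuclideanSpace ℝ (Fin n)) '' T)
    (hDcard : (D.ncard : ℝ) = ρ ^ (n * (w - 1)) * (ρ ^ n - 1) + 1) :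
    dimH (frontier (fundamentalDomain Φ w D)) < (n : ENNReal) := by
  classical
  have hρ0 : 0 < ρ := one_pos.trans hρ
  have hρn1 : 1 < ρ ^ n := one_lt_pow₀ hρ (by omega)
  have hΦ : ∀ x, N (Φ x) = ρ * N x := HasInducedNorm.eq_mul hN hρ0 hNΦ hNΦinv
  have hDf : D.Finite := by
    -- An infinite set has `ncard` equal to 0, whereas the prescribed cardinality is positive.
    refine Set.finite_of_ncard_ne_zero fun h => ?_
    rw [h, Nat.cast_zero] at hDcard
    have : 0 < ρ ^ (n * (w - 1)) * (ρ ^ n - 1) := mul_pos (by positivity) (by linarith)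
    linarith
  have hFc := isCompact_fundamentalDomain (w := w) hN hρ hΦ hDf
  have hFi := interior_nonempty_of_forall_exists_add Λ hFc.isClosed
    (exists_eq_add_fundamentalDomain hN hρ hΦ hΦΛ hT hr hrT hTR hw hrR hD hDf hDT)
  have : Fintype {d // d ∈ D ∧ d ≠ 0} := (hDf.subset fun d hd => hd.1).fintype
  have hcard : (Fintype.card {d // d ∈ D ∧ d ≠ 0} : ℝ) = ρ ^ (n * (w - 1)) * (ρ ^ n - 1) := by
    have h1 : Fintype.card {d // d ∈ D ∧ d ≠ 0} = (D \ {0}).ncard := by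
      rw [← Nat.card_eq_fintype_card]
      rfl
    rw [h1, ← add_left_inj (1 : ℝ), ← hDcard]
    exact_mod_cast Set.ncard_sdiff_singleton_add_one hD.zero_mem hDf
  refine dimH_frontier_lt_of_subdivision hN hρ hΦ hFc hFi _ _
    (fundamentalDomain_eq_iUnion hN hρ hΦ hDf hD.zero_mem hw) ?_ hn ?_
  · rintro (_ | d)
    · exact le_rfl
    · exact hw
  · rw [Fintype.sum_option]
    simp only [Option.elim_none, Option.elim_some, pow_one, Finset.sum_const, Finset.card_univ,
      nsmul_eq_mul]
    -- Writing w = v + 1 removes the truncated subtraction in the exponent.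
    obtain ⟨v, rfl⟩ : ∃ v, w = v + 1 := ⟨w - 1, by omega⟩
    rw [hcard, Nat.add_sub_cancel, pow_mul, inv_pow, pow_succ]
    field_simp
    ring
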